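/- **Theorem (FCFS capture fraction).** Let $0<\rho<D$, $v\in[0,1)$, $\lambda\ge 0$, and assume $D\ge(1+v)\rho$ (a vehicle at the center can capture every newly arriving target). Targets arrive according to a Poisson process of rate $\lambda$ on $[0,\infty)$ (none if $\lambda=0$), at independent uniformly distributed points of the circle of radius $D$ about the origin of $\mathbb R^2$, and each moves radially inward with speed $v$. A vehicle with maximal speed $1$ starts at the origin. A target is captured when the vehicle is collocated with it while its distance from the origin is in $[\rho,D]$; it escapes when it reaches the perimeter (distance $\rho$) without being captured. Under the first-come-first-served (FCFS) policy the vehicle takes the targets in the order of their arrival: whenever it is free, it moves straight, at unit speed, to the earliest possible interception of the oldest uncaptured target that has arrived and that it can still capture from its current position; if there is no such target, it moves straight to the origin at unit speed and waits there until one arrives. Let $n_{\rm capt}(t)$ and $n_{\rm esc}(t)$ be the numbers of targets captured and escaped by time $t$, and let $$\mathbb F_{\rm cap}(\mathrm{FCFS})=\limsup_{t\to\infty}\,\mathbb E\!\left[\frac{n_{\rm capt}(t)}{n_{\rm capt}(t)+n_{\rm esc}(t)}\right],$$ where the fraction is taken to be $1$ when $n_{\rm capt}(t)+n_{\rm esc}(t)=0$.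 Then $$\mathbb F_{\rm cap}(\mathrm{FCFS})\ \ge\ \frac1{1+2\lambda\rho}.$$ -/

import Mathlib

open scoped ENNReal

noncomputable section

namespace RIT

/-- A realisation of the arriving targets, listed in order of arrival: `arr n` is the arrival
time of the `n`-th target (`⊤` if there is no such target) and `ang n` its polar angle. -/
structure TargetStream where
  arr : ℕ → ℝ≥0∞
  ang : ℕ → ℝ

/-- Target `n` has arrived by time `t`. -/
def arrived (S : TargetStream) (n : ℕ) (t : ℝ) : Prop :=
  S.arr n ≠ ⊤ ∧ (S.arr n).toReal ≤ t

/-- Distance of target `n` from the center at time `t`: it starts on the circle of radius `D` at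
its arrival time and moves radially inward with speed `v`. -/
def radius (D v : ℝ) (S : TargetStream) (n : ℕ) (t : ℝ) : ℝ :=
  D - v * (t - (S.arr n).toReal)

/-- Position of target `n` at time `t`; the plane is `ℂ` and the center of the environment `0`. -/
def targetPos (D v : ℝ) (S : TargetStream) (n : ℕ) (t : ℝ) : ℂ :=
  (radius D v S n t : ℂ) * Complex.exp ((S.ang n : ℂ) * Complex.I)

/-- Target `n` (unless captured before) is in the annulus `ρ ≤ r ≤ D` at time `t`. -/
def inEnv (ρ D v : ℝ) (S : TargetStream) (n : ℕ) (t : ℝ) : Prop :=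
  arrived S n t ∧ ρ ≤ radius D v S n t

/-- The times at which a vehicle of unit speed that is at `q` at time `s` can be collocated with
target `n` while that target is in the environment. -/
def interceptTimes (ρ D v : ℝ) (S : TargetStream) (n : ℕ) (s : ℝ) (q : ℂ) : Set ℝ :=
  {u | s ≤ u ∧ inEnv ρ D v S n u ∧ dist q (targetPos D v S n u) ≤ u - s}

/-- Target `n` can be captured by a vehicle that is at `q` at time `s`. -/
def capturable (ρ D v : ℝ) (S : TargetStream) (n : ℕ) (s : ℝ) (q : ℂ) : Prop :=
  (interceptTimes ρ D v S n s q).Nonempty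

/-- Where a vehicle is at time `τ` after leaving `q` straight for `w` with unit speed, if it
stops at `w`. -/
def moveToward (q w : ℂ) (τ : ℝ) : ℂ :=
  q + ((min 1 (τ / dist q w) : ℝ) : ℂ) * (w - q)

/-- A motion of the vehicle, together with the time `free` of its last planned interception;
from then on it moves to the center and waits there. -/
structure Plan where
  path : ℝ → ℂ
  free : ℝ

/-- The vehicle waits at the center. -/
def Plan.idle : Plan where
  path := fun _ => 0
  free := 0

/-- Target `n` is met by the vehicle by the time it has made its planned interceptions. -/
def Plan.meets (ρ D v : ℝ) (S : TargetStream) (P : Plan) (n : ℕ) : Prop :=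
  ∃ u ≤ P.free, inEnv ρ D v S n u ∧ P.path u = targetPos D v S n u

/-- The earliest time at which the vehicle can turn to target `n`: the target has arrived and all
interceptions of older targets have been made. -/
def Plan.turnTime (S : TargetStream) (P : Plan) (n : ℕ) : ℝ :=
  max P.free (S.arr n).toReal

open Classical in
/-- Adding target `n` to a plan `P` made for the older targets. A target that is met on the way,
or that can no longer be captured when its turn comes, leaves the plan unchanged. Otherwise, when
its turn comes, the vehicle moves straight to the earliest possible interception, and then back
toward the center. -/
def Plan.extend (ρ D v : ℝ) (S : TargetStream) (P : Plan) (n : ℕ) : Plan :=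
  let s := P.turnTime S n
  let q := P.path s
  if P.meets ρ D v S n ∨ ¬ capturable ρ D v S n s q then P
  else
    let u := sInf (interceptTimes ρ D v S n s q)
    let w := targetPos D v S n u
    { path := fun t =>
        if t ≤ s then P.path t
        else if t ≤ u then moveToward q w (t - s)
        else moveToward w 0 (t - u)
      free := u }

/-- The first-come-first-served plan for the first `n` targets. -/
def fcfsPlan (ρ D v : ℝ) (S : TargetStream) : ℕ → Plan
  | 0 => Plan.idle
  | n + 1 => (fcfsPlan ρ D v S n).extend ρ D v S n

/-- The number of targets that have arrived by time `t`. -/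
def numArrived (S : TargetStream) (t : ℝ) : ℕ :=
  {n | arrived S n t}.ncard

/-- The position at time `t` of the vehicle under the first-come-first-served policy: it follows
the plan for the targets that have arrived so far. -/
def fcfsPos (ρ D v : ℝ) (S : TargetStream) (t : ℝ) : ℂ :=
  (fcfsPlan ρ D v S (numArrived S t)).path t

/-- A vehicle with trajectory `p` has captured target `n` by time `t`: at some time up to `t` it
was collocated with the target while the target was in the environment. -/
def captured (ρ D v : ℝ) (S : TargetStream) (p : ℝ → ℂ) (n : ℕ) (t : ℝ) : Prop :=
  ∃ u ≤ t, inEnv ρ D v S n u ∧ p u = targetPos D v S n u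

/-- Target `n` has escaped by time `t`: it has reached the perimeter without being captured. -/
def escaped (ρ D v : ℝ) (S : TargetStream) (p : ℝ → ℂ) (n : ℕ) (t : ℝ) : Prop :=
  arrived S n t ∧ radius D v S n t ≤ ρ ∧ ¬ captured ρ D v S p n t

def numCaptured (ρ D v : ℝ) (S : TargetStream) (p : ℝ → ℂ) (t : ℝ) : ℕ :=
  {n | captured ρ D v S p n t}.ncard

def numEscaped (ρ D v : ℝ) (S : TargetStream) (p : ℝ → ℂ) (t : ℝ) : ℕ :=
  {n | escaped ρ D v S p n t}.ncard

/-- The fraction of the captured targets among the captured and the escaped ones at time `t`;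
it is `1` as long as there are neither. -/
def captureRatio (ρ D v : ℝ) (S : TargetStream) (p : ℝ → ℂ) (t : ℝ) : ℝ≥0∞ :=
  if numCaptured ρ D v S p t + numEscaped ρ D v S p t = 0 then 1
  else (numCaptured ρ D v S p t : ℝ≥0∞) /
    ((numCaptured ρ D v S p t : ℝ≥0∞) + (numEscaped ρ D v S p t : ℝ≥0∞))

/-- The targets with interarrival times `gap` (the first one counted from time `0`) and angles
`ang`. -/
def stream {Ω : Type*} (gap : ℕ → Ω → ℝ≥0∞) (ang : ℕ → Ω → ℝ) (ω : Ω) : TargetStream where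
  arr := fun n => ∑ k ∈ Finset.range (n + 1), gap k ω
  ang := fun n => ang n ω

/-- Targets arrive as a Poisson process of rate `lam` at independent uniform angles: the
interarrival times are independent and exponential with rate `lam` (almost surely infinite, so
that no target ever arrives, if `lam = 0`), and independent of the angles, which are independent
and uniform on `[0, 2π)`. -/
structure IsPoissonUniform {Ω : Type*} [MeasurableSpace Ω] (μ : MeasureTheory.Measure Ω)
    (lam : ℝ) (gap : ℕ → Ω → ℝ≥0∞) (ang : ℕ → Ω → ℝ) : Prop where
  measurable_gap : ∀ n, Measurable (gap n)
  measurable_ang : ∀ n, Measurable (ang n)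
  gap_law : ∀ n, ∀ t : ℝ, 0 ≤ t →
    μ {ω | ENNReal.ofReal t < gap n ω} = ENNReal.ofReal (Real.exp (-(lam * t)))
  ang_law : ∀ n, MeasureTheory.pdf.IsUniform (ang n) (Set.Ico 0 (2 * Real.pi)) μ
    MeasureTheory.volume
  indep_gap_ang : ∀ n, ProbabilityTheory.IndepFun (gap n) (ang n) μ
  indep : ProbabilityTheory.iIndepFun (fun n ω => (gap n ω, ang n ω)) μ

/-- The capture fraction: upper limit, as time goes to infinity, of the expected fraction of
captured targets, for a policy that produces the trajectory `policy S` when the arriving targets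
are `S`. -/
def captureFraction {Ω : Type*} [MeasurableSpace Ω] (μ : MeasureTheory.Measure Ω) (ρ D v : ℝ)
    (gap : ℕ → Ω → ℝ≥0∞) (ang : ℕ → Ω → ℝ) (policy : TargetStream → ℝ → ℂ) : ℝ≥0∞ :=
  Filter.limsup
    (fun t : ℝ => ∫⁻ ω, captureRatio ρ D v (stream gap ang ω) (policy (stream gap ang ω)) t ∂μ)
    Filter.atTop

end RIT

end

namespace RIT

/-! ### Geometry of the first-come-first-served plan -/

section Deterministic

variable {ρ D v : ℝ} {S : TargetStream}

/-! Let v > 0 and lam > 0. After intercepting target i at radius r, the vehicle can be back at the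
center r later and at any perimeter point another ρ later. Target i itself needed (r - ρ) / v ≥ r -
ρ more to reach the perimeter, so the vehicle can be anywhere on the perimeter at most 2ρ after
target i was due there. All targets take the same time (D - ρ) / v to get there. Hence a target
arriving at least 2ρ after the last planned interception target is still capturable at its turn; if
the vehicle is already at the center, `hcenter` suffices. So every target arrives less than 2ρ after
a secured one (`exists_secured`), and the secured targets are at least as many as the arrivals
picked greedily more than 2ρ apart (`greedyCount_le_card`).

For Poisson arrivals a greedy cycle is a dead time L = 2ρ followed by a memoryless wait of mean 1 /
lam, so it contains 1 + lam * L arrivals on average. The exact form of this is E[lam * min b x +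
1_{b < x}] = 1 for an exponential x, summed along the sequence (`greedyCount_identity`,
`le_integral_greedyCount`). By the strong law, the number of targets due at the perimeter by time t
and the number arrived by t are asymptotically equal, which turns the count into a fraction
(`captureFraction_fcfs_ge`). -/

theorem setOf_arrived_eq_Iio (hfin : ∀ n, S.arr n ≠ ⊤) (hmono : Monotone fun n => (S.arr n).toReal)
    (hunb : ∀ t : ℝ, ∃ n, t < (S.arr n).toReal) (t : ℝ) :
    ∃ N, {n | arrived S n t} = Set.Iio N := by
  classical
  refine ⟨Nat.find (hunb t), ?_⟩
  ext n
  simp only [arrived, Set.mem_ofPred_eq, Set.mem_Iio, Nat.lt_find_iff, not_lt]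
  exact ⟨fun h m hm => (hmono hm).trans h.2, fun h => ⟨hfin n, h n le_rfl⟩⟩

theorem finite_arrived (hfin : ∀ n, S.arr n ≠ ⊤) (hmono : Monotone fun n => (S.arr n).toReal)
    (hunb : ∀ t : ℝ, ∃ n, t < (S.arr n).toReal) (t : ℝ) : {n | arrived S n t}.Finite := by
  obtain ⟨N, hN⟩ := setOf_arrived_eq_Iio hfin hmono hunb t
  exact hN ▸ Set.finite_Iio N

theorem lt_numArrived_iff (hfin : ∀ n, S.arr n ≠ ⊤) (hmono : Monotone fun n => (S.arr n).toReal)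
    (hunb : ∀ t : ℝ, ∃ n, t < (S.arr n).toReal) (n : ℕ) (t : ℝ) :
    n < numArrived S t ↔ arrived S n t := by
  obtain ⟨N, hN⟩ := setOf_arrived_eq_Iio hfin hmono hunb t
  have h : numArrived S t = N := by simp [numArrived, hN]
  have h' : n ∈ {n | arrived S n t} ↔ n ∈ Set.Iio N := by rw [hN]
  simpa [h] using h'.symm

theorem isClosed_interceptTimes (n : ℕ) (s : ℝ) (q : ℂ) :
    IsClosed (interceptTimes ρ D v S n s q) := by
  have hr : Continuous (radius D v S n) := by unfold radius; fun_prop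
  have hp : Continuous (targetPos D v S n) := by unfold targetPos; fun_prop
  by_cases h : S.arr n = ⊤
  · have : interceptTimes ρ D v S n s q = ∅ := by
      ext u; simp [interceptTimes, inEnv, arrived, h]
    rw [this]; exact isClosed_empty
  · have : interceptTimes ρ D v S n s q =
        {u | s ≤ u} ∩ ({u | (S.arr n).toReal ≤ u} ∩ {u | ρ ≤ radius D v S n u}) ∩
          {u | dist q (targetPos D v S n u) ≤ u - s} := by
      ext u; simp [interceptTimes, inEnv, arrived, h, and_assoc]
    rw [this]
    exact ((isClosed_le continuous_const continuous_id).inter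
      ((isClosed_le continuous_const continuous_id).inter (isClosed_le continuous_const hr))).inter
      (isClosed_le (by fun_prop) (by fun_prop))

theorem sInf_mem_interceptTimes {n : ℕ} {s : ℝ} {q : ℂ} (h : capturable ρ D v S n s q) :
    sInf (interceptTimes ρ D v S n s q) ∈ interceptTimes ρ D v S n s q :=
  (isClosed_interceptTimes n s q).csInf_mem h ⟨s, fun _ hu => hu.1⟩

theorem moveToward_eq_of_dist_le {q w : ℂ} {τ : ℝ} (h : dist q w ≤ τ) : moveToward q w τ = w := by
  rcases (dist_nonneg (x := q) (y := w)).eq_or_lt with h0 | h0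
  · have : q = w := dist_eq_zero.1 h0.symm
    simp [moveToward, this]
  · have : min 1 (τ / dist q w) = 1 := min_eq_left ((one_le_div h0).2 h)
    simp [moveToward, this]

theorem norm_moveToward_zero_le {w : ℂ} {τ : ℝ} (hτ : 0 ≤ τ) :
    ‖moveToward w 0 τ‖ ≤ max 0 (‖w‖ - τ) := by
  by_cases h : ‖w‖ ≤ τ
  · rw [moveToward_eq_of_dist_le (by simpa using h)]
    simp
  · push Not at h
    have hw : 0 < ‖w‖ := hτ.trans_lt h
    have hm : min 1 (τ / dist w 0) = τ / ‖w‖ := by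
      rw [dist_zero_right]; exact min_eq_right ((div_le_one hw).2 h.le)
    have he : moveToward w 0 τ = ((1 - τ / ‖w‖ : ℝ) : ℂ) * w := by
      rw [moveToward, hm]; push_cast; ring
    have h1 : τ / ‖w‖ ≤ 1 := (div_le_one hw).2 h.le
    rw [he, norm_mul, Complex.norm_real, Real.norm_of_nonneg (by linarith), sub_mul,
      div_mul_cancel₀ _ hw.ne', one_mul]
    exact le_max_right _ _

theorem norm_targetPos {n : ℕ} {t : ℝ} (h : 0 ≤ radius D v S n t) :
    ‖targetPos D v S n t‖ = radius D v S n t := by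
  rw [targetPos, norm_mul, Complex.norm_exp_ofReal_mul_I, mul_one, Complex.norm_real,
    Real.norm_of_nonneg h]

/-- Target `n` is met by the plan for the older targets, or is capturable when its turn comes. -/
def secured (ρ D v : ℝ) (S : TargetStream) (n : ℕ) : Prop :=
  (fcfsPlan ρ D v S n).meets ρ D v S n ∨
    capturable ρ D v S n ((fcfsPlan ρ D v S n).turnTime S n)
      ((fcfsPlan ρ D v S n).path ((fcfsPlan ρ D v S n).turnTime S n))

/-- When it has made its planned interceptions, the plan `P` is at the secured
target `i`, which is then in the environment, and returns from there to the center. -/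
def Plan.ReturnsFrom (ρ D v : ℝ) (S : TargetStream) (P : Plan) (i : ℕ) : Prop :=
  secured ρ D v S i ∧ inEnv ρ D v S i P.free ∧
    ∀ t, P.free ≤ t → P.path t = moveToward (targetPos D v S i P.free) 0 (t - P.free)

/-- The two branches of `Plan.extend`, in the form used below. In the second, the earliest
interception is attained because the set of interception times is closed. -/
theorem extend_cases (P : Plan) (n : ℕ) :
    ((P.meets ρ D v S n ∨
        ¬ capturable ρ D v S n (P.turnTime S n) (P.path (P.turnTime S n))) ∧
      P.extend ρ D v S n = P) ∨
    (capturable ρ D v S n (P.turnTime S n) (P.path (P.turnTime S n)) ∧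
      P.turnTime S n ≤ (P.extend ρ D v S n).free ∧
      inEnv ρ D v S n (P.extend ρ D v S n).free ∧
      (∀ t ≤ P.turnTime S n, (P.extend ρ D v S n).path t = P.path t) ∧
      ∀ t, (P.extend ρ D v S n).free ≤ t → (P.extend ρ D v S n).path t =
        moveToward (targetPos D v S n (P.extend ρ D v S n).free) 0
          (t - (P.extend ρ D v S n).free)) := by
  by_cases h : P.meets ρ D v S n ∨
      ¬ capturable ρ D v S n (P.turnTime S n) (P.path (P.turnTime S n))
  · left
    exact ⟨h, by simp only [Plan.extend, if_pos h]⟩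
  · right
    have hc : capturable ρ D v S n (P.turnTime S n) (P.path (P.turnTime S n)) := by
      by_contra hc; exact h (Or.inr hc)
    obtain ⟨h1, h2, h3⟩ := sInf_mem_interceptTimes hc
    have hw := moveToward_eq_of_dist_le h3
    simp only [Plan.extend, if_neg h]
    set s := P.turnTime S n
    set u := sInf (interceptTimes ρ D v S n s (P.path s))
    refine ⟨hc, h1, h2, fun t ht => if_pos ht, fun t ht => ?_⟩
    rcases ht.eq_or_lt with rfl | ht
    · have h0 : ∀ w : ℂ, moveToward w 0 (u - u) = w := by simp [moveToward]
      rw [h0]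
      -- If u ≤ s then u = s: the vehicle is already at the target, and the path at u is still that
      -- of `P`.
      by_cases hus : u ≤ s
      · have : s = u := le_antisymm h1 hus
        rw [if_pos hus]
        rw [← this, sub_self] at h3
        rw [← this]
        exact dist_le_zero.1 h3
      · rw [if_neg hus, if_pos le_rfl, hw]
    · rw [if_neg (by linarith), if_neg (by linarith)]

theorem fcfsPlan_returnsFrom (n : ℕ) :
    fcfsPlan ρ D v S n = Plan.idle ∨ ∃ i < n, (fcfsPlan ρ D v S n).ReturnsFrom ρ D v S i := by
  induction n with
  | zero => exact Or.inl rfl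
  | succ n ih =>
    rw [fcfsPlan]
    rcases extend_cases (ρ := ρ) (D := D) (v := v) (S := S) (fcfsPlan ρ D v S n) n with
      ⟨-, h⟩ | ⟨hc, -, h2, -, h4⟩
    · rw [h]
      exact ih.imp_right fun ⟨i, hi, h⟩ => ⟨i, hi.trans n.lt_succ_self, h⟩
    · exact Or.inr ⟨n, n.lt_succ_self, Or.inr hc, h2, h4⟩

/-- An extension alters the motion only after the turn time, which is no earlier than `free`. -/
theorem fcfsPlan_agree {n N : ℕ} (h : n ≤ N) :
    (fcfsPlan ρ D v S n).free ≤ (fcfsPlan ρ D v S N).free ∧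
      ∀ t ≤ (fcfsPlan ρ D v S n).free,
        (fcfsPlan ρ D v S N).path t = (fcfsPlan ρ D v S n).path t := by
  induction N, h using Nat.le_induction with
  | base => exact ⟨le_rfl, fun _ _ => rfl⟩
  | succ N _ ih =>
    rw [fcfsPlan]
    rcases extend_cases (ρ := ρ) (D := D) (v := v) (S := S) (fcfsPlan ρ D v S N) N with
      ⟨-, h⟩ | ⟨-, h1, -, h3, -⟩
    · rwa [h]
    · have hs : (fcfsPlan ρ D v S N).free ≤ (fcfsPlan ρ D v S N).turnTime S N := le_max_left _ _
      exact ⟨ih.1.trans (hs.trans h1),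
        fun t ht => (h3 t (ht.trans (ih.1.trans hs))).trans (ih.2 t ht)⟩

/-- The interception foreseen by the plan really happens, since later arrivals do not change the
motion up to it; it happens before the target is due at the perimeter. -/
theorem captured_of_secured (hv : 0 < v) (hfin : ∀ n, S.arr n ≠ ⊤)
    (hmono : Monotone fun n => (S.arr n).toReal) (hunb : ∀ t : ℝ, ∃ n, t < (S.arr n).toReal)
    {n : ℕ} {t : ℝ} (hs : secured ρ D v S n) (ht : (S.arr n).toReal + (D - ρ) / v ≤ t) :
    captured ρ D v S (fcfsPos ρ D v S) n t := by
  have hle : ∀ u, inEnv ρ D v S n u → u ≤ t := fun u hu => by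
    have h1 : v * (u - (S.arr n).toReal) ≤ D - ρ := by have := hu.2; unfold radius at this; linarith
    have h2 : u - (S.arr n).toReal ≤ (D - ρ) / v := by rw [le_div_iff₀ hv]; linarith
    linarith
  have key : ∀ u, inEnv ρ D v S n u → ∀ m ≤ n + 1, u ≤ (fcfsPlan ρ D v S m).free →
      (fcfsPlan ρ D v S m).path u = targetPos D v S n u →
      captured ρ D v S (fcfsPos ρ D v S) n t := fun u hu m hm hf hp => by
    refine ⟨u, hle u hu, hu, ?_⟩
    -- Target `n` has arrived by time `u`, so the plan in force at `u` takes at least `n + 1`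
    -- targets into account.
    have : m ≤ numArrived S u := hm.trans ((lt_numArrived_iff hfin hmono hunb n u).2 hu.1)
    rw [fcfsPos, (fcfsPlan_agree this).2 u hf, hp]
  have hmeets : (fcfsPlan ρ D v S n).meets ρ D v S n →
      captured ρ D v S (fcfsPos ρ D v S) n t := fun ⟨u, hu, he, hp⟩ =>
    key u he n n.le_succ hu hp
  rcases extend_cases (ρ := ρ) (D := D) (v := v) (S := S) (fcfsPlan ρ D v S n) n with
      ⟨h, -⟩ | ⟨-, h1, h2, -, h4⟩
  · exact hmeets (hs.elim id fun hc => h.resolve_right (not_not_intro hc))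
  · refine key _ h2 (n + 1) le_rfl le_rfl ?_
    have := h4 _ le_rfl
    rw [fcfsPlan, this]
    simp [moveToward]

/-- The vehicle can meet the target where it reaches the perimeter: by the triangle inequality
through the center, that point is at distance at most ‖q‖ + ρ. -/
theorem capturable_of_norm_add_le (hv : 0 < v) (hρ : 0 ≤ ρ) (hD : ρ ≤ D) {n : ℕ}
    (hfin : S.arr n ≠ ⊤) {s : ℝ} {q : ℂ} (h : ‖q‖ + ρ ≤ (S.arr n).toReal + (D - ρ) / v - s) :
    capturable ρ D v S n s q := by
  have hr : radius D v S n ((S.arr n).toReal + (D - ρ) / v) = ρ := by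
    unfold radius; field_simp; ring
  have hK : 0 ≤ (D - ρ) / v := div_nonneg (by linarith) hv.le
  refine ⟨(S.arr n).toReal + (D - ρ) / v, ?_, ⟨⟨hfin, by linarith⟩, hr.ge⟩, ?_⟩
  · linarith [norm_nonneg q]
  · refine le_trans ?_ h
    rw [dist_eq_norm]
    refine (norm_sub_le _ _).trans ?_
    rw [norm_targetPos (hr.symm ▸ hρ), hr]

/-- Every target arrives less than `2 * ρ` after a secured one. -/
theorem exists_secured (hρ : 0 < ρ) (hD : ρ < D) (hv : 0 < v) (hv1 : v < 1)
    (hcenter : (1 + v) * ρ ≤ D) (hfin : ∀ n, S.arr n ≠ ⊤) (n : ℕ) :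
    ∃ i ≤ n, secured ρ D v S i ∧ (S.arr n).toReal < (S.arr i).toReal + 2 * ρ := by
  have hK : ρ ≤ (D - ρ) / v := by rw [le_div_iff₀ hv]; linarith
  by_cases hs : secured ρ D v S n
  · exact ⟨n, le_rfl, hs, by linarith⟩
  rcases fcfsPlan_returnsFrom (ρ := ρ) (D := D) (v := v) (S := S) n with h | ⟨i, hi, hsi, he, hp⟩
  · refine absurd (Or.inr (capturable_of_norm_add_le hv hρ.le hD.le (hfin n) ?_)) hs
    rw [h]
    simp only [Plan.idle, Plan.turnTime, norm_zero, max_eq_right ENNReal.toReal_nonneg]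
    linarith
  · refine ⟨i, hi.le, hsi, ?_⟩
    by_contra! hlt
    refine hs (Or.inr (capturable_of_norm_add_le hv hρ.le hD.le (hfin n) ?_))
    set P := fcfsPlan ρ D v S n
    have hsu : P.free ≤ P.turnTime S n := le_max_left _ _
    rw [hp _ hsu]
    have hr := he.2
    have hw := norm_targetPos (hρ.le.trans hr)
    have hn := norm_moveToward_zero_le (w := targetPos D v S i P.free) (sub_nonneg.2 hsu)
    rw [hw] at hn
    set r := radius D v S i P.free with hrdef
    have hu : P.free = (S.arr i).toReal + (D - r) / v := by
      rw [hrdef, radius]; field_simp; ring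
    -- This is where v < 1 enters: the rest of the target's way inward takes it at least as long as
    -- it would take the vehicle.
    have hrv : r - ρ ≤ (r - ρ) / v := by
      rw [le_div_iff₀ hv]; nlinarith
    have hsum : (D - r) / v + (r - ρ) / v = (D - ρ) / v := by ring
    -- `h2` serves when the vehicle is still on its way back at its turn, `h1` when it has reached
    -- the center.
    have h2 : r + P.free + ρ ≤ (S.arr n).toReal + (D - ρ) / v := by linarith
    have h1 : P.turnTime S n + ρ ≤ (S.arr n).toReal + (D - ρ) / v := by
      rcases max_choice P.free (S.arr n).toReal with h | h
      · rw [Plan.turnTime, h]; linarith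
      · rw [Plan.turnTime, h]; linarith
    rcases max_choice 0 (r - (P.turnTime S n - P.free)) with h | h
    · rw [h] at hn; linarith
    · rw [h] at hn; linarith

/-! ### Greedy choice of separated points -/

/-- The time left before the greedy sequence of points, chosen more than `L` apart among the points
with increments `x`, may choose another point, seen from the `n`-th point. -/
noncomputable def remaining (L : ℝ) (x : ℕ → ℝ) : ℕ → ℝ
  | 0 => L
  | n + 1 => if remaining L x n < x (n + 1) then L else remaining L x n - x (n + 1)

/-- The number of greedily chosen points among the points `0, …, n`. -/
noncomputable def greedyCount (L : ℝ) (x : ℕ → ℝ) (n : ℕ) : ℕ :=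
  1 + ∑ k ∈ Finset.range n, if remaining L x k < x (k + 1) then 1 else 0

theorem remaining_mem_Icc {L : ℝ} (hL : 0 ≤ L) {x : ℕ → ℝ} (hx : ∀ n, 0 ≤ x n) (n : ℕ) :
    remaining L x n ∈ Set.Icc 0 L := by
  induction n with
  | zero => exact ⟨hL, le_rfl⟩
  | succ n ih =>
    rw [remaining]
    split_ifs with h
    · exact ⟨hL, le_rfl⟩
    · exact ⟨by linarith, by linarith [ih.2, hx (n + 1)]⟩

theorem greedyCount_le (L : ℝ) (x : ℕ → ℝ) (n : ℕ) : greedyCount L x n ≤ n + 1 := by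
  have : ∑ k ∈ Finset.range n, (if remaining L x k < x (k + 1) then 1 else 0) ≤
      ∑ k ∈ Finset.range n, 1 := Finset.sum_le_sum fun k _ => by split_ifs <;> simp
  simp only [Finset.sum_const, Finset.card_range, smul_eq_mul, mul_one] at this
  unfold greedyCount; omega

open Classical in
/-- A set of points that covers all points by intervals of length `L` to the right has at least as
many points as the greedy sequence. -/
theorem greedyCount_le_card {L : ℝ} {a : ℕ → ℝ} (ha : Monotone a) {x : ℕ → ℝ}
    (hx : ∀ n, a (n + 1) = a n + x (n + 1)) {p : ℕ → Prop}
    (hp : ∀ n, ∃ i ≤ n, p i ∧ a n < a i + L) (n : ℕ) :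
    greedyCount L x n ≤ ((Finset.range (n + 1)).filter p).card := by
  suffices ∃ j ≤ n, a n + remaining L x n = a j + L ∧
      greedyCount L x n ≤ ((Finset.range (j + 1)).filter p).card by
    obtain ⟨j, hj, -, h⟩ := this
    exact h.trans (Finset.card_le_card (Finset.filter_subset_filter _
      (Finset.range_subset_range.2 (by omega))))
  induction n with
  | zero =>
    refine ⟨0, le_rfl, rfl, ?_⟩
    obtain ⟨i, hi, hpi, -⟩ := hp 0
    obtain rfl : i = 0 := by omega
    have : 0 ∈ (Finset.range 1).filter p := by simp [hpi]
    simpa [greedyCount] using Finset.card_pos.2 ⟨0, this⟩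
  | succ n ih =>
    obtain ⟨j, hj, hrem, hc⟩ := ih
    have hg : greedyCount L x (n + 1) =
        greedyCount L x n + if remaining L x n < x (n + 1) then 1 else 0 := by
      simp only [greedyCount, Finset.sum_range_succ]; omega
    by_cases h : remaining L x n < x (n + 1)
    · refine ⟨n + 1, le_rfl, by simp [remaining, h], ?_⟩
      obtain ⟨i, hi, hpi, hlt⟩ := hp (n + 1)
      -- The last chosen point `j` is more than `L` before the new point, so the point of `p`
      -- covering the latter comes after `j` and has not been counted yet.
      have hij : j < i := by
        by_contra! hij
        have := ha hij
        have := hx n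
        linarith
      rw [hg, if_pos h]
      have hss : insert i ((Finset.range (j + 1)).filter p) ⊆
          (Finset.range (n + 1 + 1)).filter p := by
        intro k hk
        simp only [Finset.mem_insert, Finset.mem_filter, Finset.mem_range] at hk ⊢
        rcases hk with rfl | ⟨h1, h2⟩
        · exact ⟨by omega, hpi⟩
        · exact ⟨by omega, h2⟩
      have := Finset.card_le_card hss
      rw [Finset.card_insert_of_notMem (by simp; omega)] at this
      omega
    · refine ⟨j, by omega, ?_, by simpa [hg, h] using hc⟩
      rw [remaining, if_neg h, hx]; linarith

theorem captureRatio_eq_one_of_numEscaped_eq_zero {p : ℝ → ℂ} {t : ℝ}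
    (h : numEscaped ρ D v S p t = 0) : captureRatio ρ D v S p t = 1 := by
  unfold captureRatio
  rw [h]
  split_ifs with h0
  · rfl
  · simp only [add_zero, Nat.cast_zero] at h0 ⊢
    exact ENNReal.div_self (by exact_mod_cast h0) (ENNReal.natCast_ne_top _)

/-- Pathwise lower bound for the capture ratio of the first-come-first-served policy. -/
theorem greedyCount_div_le_captureRatio (hρ : 0 < ρ) (hD : ρ < D) (hv : 0 < v) (hv1 : v < 1)
    (hcenter : (1 + v) * ρ ≤ D) (hfin : ∀ n, S.arr n ≠ ⊤)
    (hmono : Monotone fun n => (S.arr n).toReal) (hunb : ∀ t : ℝ, ∃ n, t < (S.arr n).toReal)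
    {x : ℕ → ℝ} (hx : ∀ n, (S.arr (n + 1)).toReal = (S.arr n).toReal + x (n + 1))
    {m N : ℕ} {t : ℝ} (hm : (S.arr m).toReal + (D - ρ) / v ≤ t) (hN : t < (S.arr N).toReal) :
    (greedyCount (2 * ρ) x m : ℝ≥0∞) / N ≤ captureRatio ρ D v S (fcfsPos ρ D v S) t := by
  classical
  set p := fcfsPos ρ D v S
  have hfinite := finite_arrived hfin hmono hunb t
  have hsubc : {n | captured ρ D v S p n t} ⊆ {n | arrived S n t} :=
    fun n ⟨u, hu, he, _⟩ => ⟨he.1.1, he.1.2.trans hu⟩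
  have hsube : {n | escaped ρ D v S p n t} ⊆ {n | arrived S n t} := fun n h => h.1
  have hdisj : Disjoint {n | captured ρ D v S p n t} {n | escaped ρ D v S p n t} :=
    Set.disjoint_left.2 fun n h h' => h'.2.2 h
  have hmono' : {n | arrived S n t} ⊆ ↑(Finset.range N) := fun n hn => by
    simp only [Finset.coe_range, Set.mem_Iio]
    by_contra! h
    have h1 := hmono h
    have h2 := hn.2
    simp only at h1
    linarith
  -- Captured and escaped targets form disjoint sets of arrived targets, all with index below `N`.
  have hcard : numCaptured ρ D v S p t + numEscaped ρ D v S p t ≤ N := by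
    unfold numCaptured numEscaped
    rw [← Set.ncard_union_eq hdisj (hfinite.subset hsubc) (hfinite.subset hsube)]
    refine (Set.ncard_le_ncard ((Set.union_subset hsubc hsube).trans hmono')
      (Finset.finite_toSet _)).trans ?_
    rw [Set.ncard_coe_finset, Finset.card_range]
  -- By time `t` all of the targets 0, …, m are due at the perimeter, so the secured ones among them
  -- are captured.
  have hcap : greedyCount (2 * ρ) x m ≤ numCaptured ρ D v S p t := by
    refine (greedyCount_le_card hmono hx
      (fun n => exists_secured hρ hD hv hv1 hcenter hfin n) m).trans ?_
    unfold numCaptured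
    rw [← Set.ncard_coe_finset]
    refine Set.ncard_le_ncard (fun n hn => ?_) (hfinite.subset hsubc)
    simp only [Finset.coe_filter, Finset.mem_range, Set.mem_ofPred_eq] at hn
    refine captured_of_secured hv hfin hmono hunb hn.2 ?_
    have h1 := hmono (Nat.lt_succ_iff.1 hn.1)
    simp only at h1
    linarith
  unfold captureRatio
  split_ifs with h0
  · have : greedyCount (2 * ρ) x m = 0 := by omega
    simp [this]
  · gcongr
    exact_mod_cast hcard

end Deterministic

/-! ### Exponential laws and the mean number of greedily chosen points -/

section Probability

open MeasureTheory ProbabilityTheory Set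

/-- The exponential tail: `ν` lives on the nonnegative reals and gives `(t, ∞)` mass
`exp (-lam * t)`. -/
structure HasExpTail (ν : Measure ℝ) (lam : ℝ) : Prop where
  nonneg : ∀ᵐ x ∂ν, 0 ≤ x
  tail : ∀ t, 0 ≤ t → ν (Ioi t) = ENNReal.ofReal (Real.exp (-(lam * t)))

/-- The tail determines the distribution function. This provides the identical distribution required
by the strong law. -/
theorem HasExpTail.eq {ν ν' : Measure ℝ} [IsProbabilityMeasure ν] [IsProbabilityMeasure ν']
    {lam : ℝ} (h : HasExpTail ν lam) (h' : HasExpTail ν' lam) : ν = ν' := by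
  have key : ∀ {η : Measure ℝ} [IsProbabilityMeasure η], HasExpTail η lam → ∀ t,
      η (Iic t) = if t < 0 then 0 else 1 - ENNReal.ofReal (Real.exp (-(lam * t))) := by
    intro η _ hη t
    split_ifs with ht
    · refine measure_mono_null (fun x hx => ?_) (ae_iff.1 hη.nonneg)
      simp only [mem_Iic, mem_ofPred_eq, not_le] at hx ⊢
      linarith
    · rw [← compl_Ioi, prob_compl_eq_one_sub measurableSet_Ioi, hη.tail t (not_lt.1 ht)]
  exact Measure.ext_of_Iic _ _ fun t => by rw [key h, key h']

theorem HasExpTail.integral_min {ν : Measure ℝ} [IsProbabilityMeasure ν] {lam : ℝ}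
    (h : HasExpTail ν lam) (hlam : 0 < lam) {b : ℝ} (hb : 0 ≤ b) :
    ∫ x, min b x ∂ν = (1 - Real.exp (-(lam * b))) / lam := by
  have hnn : 0 ≤ᵐ[ν] fun x => min b x := by
    filter_upwards [h.nonneg] with x hx using le_min hb hx
  have hint : Integrable (fun x => min b x) ν := by
    refine Integrable.of_bound (by fun_prop) b ?_
    filter_upwards [hnn] with x hx
    rw [Real.norm_of_nonneg hx]; exact min_le_left _ _
  rw [hint.integral_eq_integral_meas_lt hnn]
  have h1 : ∀ t ∈ Ioi (0 : ℝ), ν.real {a | t < min b a} =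
      (Iio b).indicator (fun t => Real.exp (-(lam * t))) t := by
    intro t ht
    by_cases htb : t < b
    · have : {a | t < min b a} = Ioi t := by ext a; simp [htb]
      rw [indicator_of_mem (by exact htb), this, measureReal_def, h.tail t (le_of_lt ht),
        ENNReal.toReal_ofReal (Real.exp_pos _).le]
    · have : {a | t < min b a} = ∅ := by ext a; simp [htb]
      rw [indicator_of_notMem (by exact htb), this, measureReal_empty]
  rw [setIntegral_congr_fun measurableSet_Ioi h1, setIntegral_indicator measurableSet_Iio,
    Ioi_inter_Iio, ← integral_Ioc_eq_integral_Ioo, ← intervalIntegral.integral_of_le hb]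
  have hd : ∀ t ∈ uIcc 0 b, HasDerivAt (fun t => -Real.exp (-(lam * t)) / lam)
      (Real.exp (-(lam * t))) t := by
    intro t _
    have := ((((hasDerivAt_id t).const_mul lam).neg).exp.neg).div_const lam
    refine this.congr_deriv ?_
    simp only [id]; field_simp; rfl
  rw [intervalIntegral.integral_eq_sub_of_hasDerivAt hd
    (Continuous.intervalIntegrable (by fun_prop) _ _)]
  simp; ring

theorem HasExpTail.lintegral_ofReal {ν : Measure ℝ} [IsProbabilityMeasure ν] {lam : ℝ}
    (h : HasExpTail ν lam) (hlam : 0 < lam) :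
    ∫⁻ x, ENNReal.ofReal x ∂ν = ENNReal.ofReal (1 / lam) := by
  rw [lintegral_eq_lintegral_meas_lt ν h.nonneg (by fun_prop),
    setLIntegral_congr_fun (f := fun t => ν {a | t < a}) (g := fun t => ENNReal.ofReal (Real.exp (-(lam * t))))
      measurableSet_Ioi fun t ht => h.tail t (le_of_lt ht)]
  have hi := integrableOn_exp_mul_Ioi (neg_lt_zero.2 hlam) 0
  have he := integral_exp_mul_Ioi (neg_lt_zero.2 hlam) 0
  simp only [neg_mul] at hi he
  rw [← ofReal_integral_eq_lintegral_ofReal hi (ae_of_all _ fun _ => (Real.exp_pos _).le), he]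
  simp

theorem HasExpTail.integrable_id {ν : Measure ℝ} [IsProbabilityMeasure ν] {lam : ℝ}
    (h : HasExpTail ν lam) (hlam : 0 < lam) : Integrable id ν := by
  refine ⟨by fun_prop, ?_⟩
  refine (hasFiniteIntegral_iff_ofReal h.nonneg).2 ?_
  rw [h.lintegral_ofReal hlam]
  exact ENNReal.ofReal_lt_top

theorem HasExpTail.integral_id {ν : Measure ℝ} [IsProbabilityMeasure ν] {lam : ℝ}
    (h : HasExpTail ν lam) (hlam : 0 < lam) : ∫ x, x ∂ν = 1 / lam := by
  rw [integral_eq_lintegral_of_nonneg_ae h.nonneg (by fun_prop), h.lintegral_ofReal hlam,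
    ENNReal.toReal_ofReal (by positivity)]

/-- Memorylessness: an exponential clock and a deadline `b`. -/
theorem HasExpTail.integral_min_add_indicator {ν : Measure ℝ} [IsProbabilityMeasure ν] {lam : ℝ}
    (h : HasExpTail ν lam) (hlam : 0 < lam) {b : ℝ} (hb : 0 ≤ b) :
    ∫ x, (lam * min b x + if b < x then 1 else 0) ∂ν = 1 := by
  have hind : (fun x => if b < x then (1 : ℝ) else 0) = (Ioi b).indicator 1 := by
    ext x; simp [indicator_apply]
  have hint : Integrable (fun x => min b x) ν := by
    refine Integrable.of_bound (by fun_prop) b ?_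
    filter_upwards [h.nonneg] with x hx
    rw [Real.norm_of_nonneg (le_min hb hx)]; exact min_le_left _ _
  rw [integral_add (hint.const_mul lam)
    (hind ▸ (integrable_const (1 : ℝ)).indicator measurableSet_Ioi), integral_const_mul,
    h.integral_min hlam hb, hind, integral_indicator_one measurableSet_Ioi, measureReal_def,
    h.tail b hb, ENNReal.toReal_ofReal (Real.exp_pos _).le]
  field_simp; ring

theorem measurable_remaining (L : ℝ) (n : ℕ) :
    Measurable fun x : ℕ → ℝ => remaining L x n := by
  induction n with
  | zero => exact measurable_const
  | succ n ih =>
    simp only [remaining]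
    exact Measurable.ite (measurableSet_lt ih (measurable_pi_apply _)) measurable_const
      (ih.sub (measurable_pi_apply _))

theorem remaining_congr {L : ℝ} {x y : ℕ → ℝ} {n : ℕ} (h : ∀ k ≤ n, x k = y k) :
    remaining L x n = remaining L y n := by
  induction n with
  | zero => rfl
  | succ n ih => rw [remaining, remaining, ih fun k hk => h k (by omega), h _ le_rfl]

theorem measurable_greedyCount (L : ℝ) (n : ℕ) :
    Measurable fun x : ℕ → ℝ => greedyCount L x n := by
  unfold greedyCount
  refine measurable_const.add (Finset.measurable_fun_sum _ fun k _ => ?_)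
  exact Measurable.ite (measurableSet_lt (measurable_remaining L k) (measurable_pi_apply _))
    measurable_const measurable_const

variable {Ω : Type*} [MeasurableSpace Ω] {μ : Measure Ω}
  {X : ℕ → Ω → ℝ} {lam L : ℝ}

theorem indepFun_remaining (hX : ∀ n, Measurable (X n)) (hind : iIndepFun X μ) (n : ℕ) :
    IndepFun (fun ω => remaining L (fun k => X k ω) n) (X (n + 1)) μ := by
  have h := hind.indepFun_finset (Finset.range (n + 1)) {n + 1} (by simp) hX
  -- Extension by zero: `remaining` at `n` depends only on the coordinates up to `n`, so it factors
  -- through a finite vector.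
  let e : (Finset.range (n + 1) → ℝ) → ℕ → ℝ := fun y k =>
    if hk : k ∈ Finset.range (n + 1) then y ⟨k, hk⟩ else 0
  have he : Measurable e := measurable_pi_lambda _ fun k => by
    by_cases hk : k ∈ Finset.range (n + 1)
    · simp only [e, hk, dite_true]; exact measurable_pi_apply _
    · simp only [e, hk, dite_false]; exact measurable_const
  let last : ({n + 1} : Finset ℕ) := ⟨n + 1, Finset.mem_singleton_self _⟩
  have hlast : Measurable fun y : ({n + 1} : Finset ℕ) → ℝ => y last := measurable_pi_apply last
  have h' := h.comp (φ := fun y => remaining L (e y) n)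
    (ψ := fun y => y last) ((measurable_remaining L n).comp he) hlast
  refine IndepFun.congr h' (ae_of_all _ fun ω => ?_) (ae_of_all _ fun ω => rfl)
  refine remaining_congr fun k hk => ?_
  have hk' : k ∈ Finset.range (n + 1) := Finset.mem_range.2 (by omega)
  simp only [e, dif_pos hk']

variable [IsProbabilityMeasure μ]

/-- The remaining time is independent of the next increment, so by Fubini it can be frozen at a
value `b` and the memoryless identity applied. -/
theorem integral_min_remaining (hX : ∀ n, Measurable (X n)) (hind : iIndepFun X μ)
    (hlaw : ∀ n, HasExpTail (μ.map (X n)) lam) (hlam : 0 < lam) (hL : 0 ≤ L)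
    (hnn : ∀ n ω, 0 ≤ X n ω) (n : ℕ) :
    Integrable (fun ω => lam * min (remaining L (fun k => X k ω) n) (X (n + 1) ω) +
      if remaining L (fun k => X k ω) n < X (n + 1) ω then 1 else 0) μ ∧
    ∫ ω, (lam * min (remaining L (fun k => X k ω) n) (X (n + 1) ω) +
      if remaining L (fun k => X k ω) n < X (n + 1) ω then 1 else 0) ∂μ = 1 := by
  set R : Ω → ℝ := fun ω => remaining L (fun k => X k ω) n with hR
  have hRm : Measurable R := (measurable_remaining L n).comp (measurable_pi_lambda _ hX)
  have hRb : ∀ ω, R ω ∈ Icc 0 L := fun ω => remaining_mem_Icc hL (fun k => hnn k ω) n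
  let F : ℝ × ℝ → ℝ := fun z => lam * min z.1 z.2 + if z.1 < z.2 then 1 else 0
  have hF : Measurable F := ((measurable_fst.min measurable_snd).const_mul lam).add
    (Measurable.ite (measurableSet_lt measurable_fst measurable_snd) measurable_const
      measurable_const)
  have hpair : Measurable fun ω => (R ω, X (n + 1) ω) := hRm.prodMk (hX _)
  have hint : Integrable (fun ω => F (R ω, X (n + 1) ω)) μ := by
    refine Integrable.of_bound (hF.comp hpair).aestronglyMeasurable (lam * L + 1)
      (ae_of_all _ fun ω => ?_)
    have h0 : 0 ≤ min (R ω) (X (n + 1) ω) := le_min (hRb ω).1 (hnn _ _)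
    have h1 : lam * min (R ω) (X (n + 1) ω) ≤ lam * L :=
      mul_le_mul_of_nonneg_left ((min_le_left _ _).trans (hRb ω).2) hlam.le
    have h2 := mul_nonneg hlam.le h0
    rw [Real.norm_eq_abs, abs_le]
    simp only [F]
    split_ifs <;> constructor <;> linarith
  refine ⟨hint, ?_⟩
  have hprod := (indepFun_remaining (L := L) hX hind n).map_prod_eq_prod_map_map
    hRm.aemeasurable (hX _).aemeasurable
  have := Measure.isProbabilityMeasure_map (μ := μ) hRm.aemeasurable
  have := Measure.isProbabilityMeasure_map (μ := μ) (hX (n + 1)).aemeasurable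
  have hintF : Integrable F ((μ.map R).prod (μ.map (X (n + 1)))) := by
    rw [← hprod]
    exact (integrable_map_measure hF.aestronglyMeasurable hpair.aemeasurable).2 hint
  calc ∫ ω, F (R ω, X (n + 1) ω) ∂μ
      = ∫ z, F z ∂((μ.map R).prod (μ.map (X (n + 1)))) := by
        rw [← hprod, integral_map hpair.aemeasurable hF.aestronglyMeasurable]
    _ = ∫ b, ∫ x, F (b, x) ∂(μ.map (X (n + 1))) ∂(μ.map R) := integral_prod _ hintF
    _ = ∫ _, (1 : ℝ) ∂(μ.map R) := by
        refine integral_congr_ae ?_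
        have : ∀ᵐ b ∂(μ.map R), 0 ≤ b :=
          (ae_map_iff hRm.aemeasurable measurableSet_Ici).2 (ae_of_all _ fun ω => (hRb ω).1)
        filter_upwards [this] with b hb
        exact (hlaw (n + 1)).integral_min_add_indicator hlam hb
    _ = 1 := by simp

/-- Each step uses up min(remaining, x) of the remaining time, and each choice restores `L`; the sum
telescopes. -/
theorem greedyCount_identity (lam L : ℝ) (x : ℕ → ℝ) (m : ℕ) :
    (1 + lam * L) * greedyCount L x m = 1 + lam * remaining L x m +
      ∑ n ∈ Finset.range m, (lam * min (remaining L x n) (x (n + 1)) +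
        if remaining L x n < x (n + 1) then 1 else 0) := by
  induction m with
  | zero => simp [greedyCount, remaining]
  | succ m ih =>
    have hg : greedyCount L x (m + 1) =
        greedyCount L x m + if remaining L x m < x (m + 1) then 1 else 0 := by
      simp only [greedyCount, Finset.sum_range_succ]; omega
    rw [hg, Finset.sum_range_succ, remaining]
    push_cast
    by_cases h : remaining L x m < x (m + 1)
    · simp only [if_pos h, min_eq_left h.le]; linarith
    · simp only [if_neg h, min_eq_right (not_lt.1 h)]; linarith

theorem integrable_greedyCount (hX : ∀ n, Measurable (X n)) (m : ℕ) :
    Integrable (fun ω => (greedyCount L (fun k => X k ω) m : ℝ)) μ := by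
  refine Integrable.of_bound (measurable_from_top.comp ((measurable_greedyCount L m).comp
    (measurable_pi_lambda _ hX))).aestronglyMeasurable (m + 1) (ae_of_all _ fun ω => ?_)
  simp only [Real.norm_natCast]
  exact_mod_cast greedyCount_le L _ m

theorem le_integral_greedyCount (hX : ∀ n, Measurable (X n)) (hind : iIndepFun X μ)
    (hlaw : ∀ n, HasExpTail (μ.map (X n)) lam) (hlam : 0 < lam) (hL : 0 ≤ L)
    (hnn : ∀ n ω, 0 ≤ X n ω) (m : ℕ) :
    (m : ℝ) ≤ (1 + lam * L) * ∫ ω, (greedyCount L (fun k => X k ω) m : ℝ) ∂μ := by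
  have hF := integral_min_remaining hX hind hlaw hlam hL hnn
  have hsum : ∫ ω, ∑ n ∈ Finset.range m,
      (lam * min (remaining L (fun k => X k ω) n) (X (n + 1) ω) +
        if remaining L (fun k => X k ω) n < X (n + 1) ω then 1 else 0) ∂μ = m := by
    rw [integral_finsetSum _ fun n _ => (hF n).1]
    simp [(hF _).2]
  rw [← integral_const_mul, ← hsum]
  refine integral_mono (integrable_finsetSum _ fun n _ => (hF n).1)
    ((integrable_greedyCount hX m).const_mul _) fun ω => ?_
  simp only [greedyCount_identity]
  have := mul_nonneg hlam.le (remaining_mem_Icc hL (fun k => hnn k ω) m).1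
  linarith

end Probability

/-! ### Strong law and passage to the limit -/

section Limit

open MeasureTheory ProbabilityTheory Set Filter Topology

variable {Ω : Type*} [MeasurableSpace Ω] {μ : Measure Ω}
  {ρ D v lam : ℝ} {gap : ℕ → Ω → ℝ≥0∞} {ang : ℕ → Ω → ℝ}

theorem le_limsup_of_tendsto {f : ℝ → ℝ≥0∞} {t : ℕ → ℝ} {g : ℕ → ℝ≥0∞} {c : ℝ≥0∞}
    (ht : Tendsto t atTop atTop) (hg : Tendsto g atTop (𝓝 c)) (h : ∀ᶠ k in atTop, g k ≤ f (t k)) :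
    c ≤ limsup f atTop :=
  calc c = limsup g atTop := hg.limsup_eq.symm
    _ ≤ limsup (f ∘ t) atTop := limsup_le_limsup h
    _ = limsup f (map t atTop) := rfl
    _ ≤ limsup f atTop := limsup_le_limsup_of_le ht

theorem captureRatio_eq_one_of_speed_eq_zero (hD : ρ < D) (S : TargetStream) (p : ℝ → ℂ) (t : ℝ) :
    captureRatio ρ D 0 S p t = 1 := by
  refine captureRatio_eq_one_of_numEscaped_eq_zero ?_
  have : {n | escaped ρ D 0 S p n t} = ∅ := by
    ext n
    simp only [escaped, radius, mem_ofPred_eq, mem_empty_iff_false, iff_false]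
    rintro ⟨-, h, -⟩
    linarith
  simp [numEscaped, this]

theorem IsPoissonUniform.ae_gap_ne_top (h : IsPoissonUniform μ lam gap ang) (hlam : 0 < lam) :
    ∀ᵐ ω ∂μ, ∀ n, gap n ω ≠ ⊤ := by
  rw [ae_all_iff]
  intro n
  have hle : ∀ k : ℕ, μ {ω | ¬ gap n ω ≠ ⊤} ≤ ENNReal.ofReal (Real.exp (-(lam * k))) := fun k => by
    rw [← h.gap_law n k k.cast_nonneg]
    refine measure_mono fun ω hω => ?_
    simp only [ne_eq, not_not, mem_ofPred_eq] at hω ⊢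
    rw [hω]; exact ENNReal.ofReal_lt_top
  have hlim : Tendsto (fun k : ℕ => ENNReal.ofReal (Real.exp (-(lam * k)))) atTop (𝓝 0) := by
    rw [← ENNReal.ofReal_zero]
    refine (ENNReal.continuous_ofReal.tendsto 0).comp (Real.tendsto_exp_neg_atTop_nhds_zero.comp ?_)
    exact tendsto_natCast_atTop_atTop.const_mul_atTop hlam
  exact le_antisymm (ge_of_tendsto' hlim hle) zero_le

theorem IsPoissonUniform.iIndepFun_gap (h : IsPoissonUniform μ lam gap ang) :
    iIndepFun (fun n ω => (gap n ω).toReal) μ :=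
  h.indep.comp (fun _ z => z.1.toReal) fun _ => measurable_fst.ennreal_toReal

theorem IsPoissonUniform.hasExpTail (h : IsPoissonUniform μ lam gap ang) (hlam : 0 < lam) (n : ℕ) :
    HasExpTail (μ.map fun ω => (gap n ω).toReal) lam where
  nonneg := (ae_map_iff (h.measurable_gap n).ennreal_toReal.aemeasurable measurableSet_Ici).2
    (ae_of_all _ fun _ => ENNReal.toReal_nonneg)
  tail t ht := by
    rw [Measure.map_apply (h.measurable_gap n).ennreal_toReal measurableSet_Ioi,
      ← h.gap_law n t ht]
    refine measure_congr ?_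
    filter_upwards [h.ae_gap_ne_top hlam] with ω hω
    exact propext (ENNReal.ofReal_lt_iff_lt_toReal ht (hω n)).symm

variable [IsProbabilityMeasure μ]

theorem captureFraction_eq_one {policy : TargetStream → ℝ → ℂ}
    (h : ∀ᵐ ω ∂μ, ∀ t, captureRatio ρ D v (stream gap ang ω) (policy (stream gap ang ω)) t = 1) :
    captureFraction μ ρ D v gap ang policy = 1 := by
  have : ∀ t, ∫⁻ ω, captureRatio ρ D v (stream gap ang ω) (policy (stream gap ang ω)) t ∂μ = 1 :=
    fun t => by
      rw [lintegral_congr_ae (g := fun _ => 1) (by filter_upwards [h] with ω hω using hω t)]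
      simp
  simp [captureFraction, this]

/-- The first gap almost surely exceeds every natural number, hence is infinite, and no target
arrives. -/
theorem captureRatio_eq_one_of_rate_eq_zero (h : IsPoissonUniform μ 0 gap ang)
    (policy : TargetStream → ℝ → ℂ) :
    ∀ᵐ ω ∂μ, ∀ t,
      captureRatio ρ D v (stream gap ang ω) (policy (stream gap ang ω)) t = 1 := by
  have h0 : ∀ᵐ ω ∂μ, ∀ k : ℕ, ENNReal.ofReal k < gap 0 ω := by
    rw [ae_all_iff]
    intro k
    have hm : MeasurableSet {ω | ENNReal.ofReal k < gap 0 ω} :=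
      measurableSet_lt measurable_const (h.measurable_gap 0)
    refine (prob_compl_eq_zero_iff hm).2 ?_
    rw [h.gap_law 0 k k.cast_nonneg]; simp
  filter_upwards [h0] with ω hω t
  have htop : gap 0 ω = ⊤ := ENNReal.eq_top_of_forall_nnreal_le fun r => by
    obtain ⟨k, hk⟩ := exists_nat_ge r
    refine le_trans ?_ (hω k).le
    rw [ENNReal.ofReal_natCast]
    exact_mod_cast hk
  refine captureRatio_eq_one_of_numEscaped_eq_zero ?_
  have : ∀ n, (stream gap ang ω).arr n = ⊤ := fun n => by
    simp only [stream]
    exact ENNReal.sum_eq_top.2 ⟨0, by simp, htop⟩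
  simp [numEscaped, escaped, arrived, this]

theorem IsPoissonUniform.tendsto_sum_div (h : IsPoissonUniform μ lam gap ang) (hlam : 0 < lam) :
    ∀ᵐ ω ∂μ, Tendsto (fun n : ℕ => (∑ i ∈ Finset.range n, (gap i ω).toReal) / n) atTop
      (𝓝 (1 / lam)) := by
  have hm : ∀ n, Measurable fun ω => (gap n ω).toReal :=
    fun n => (h.measurable_gap n).ennreal_toReal
  have hpm : ∀ n, IsProbabilityMeasure (μ.map fun ω => (gap n ω).toReal) :=
    fun n => Measure.isProbabilityMeasure_map (hm n).aemeasurable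
  have hint : Integrable (fun ω => (gap 0 ω).toReal) μ :=
    (integrable_map_measure (by fun_prop) (hm 0).aemeasurable).1
      ((h.hasExpTail hlam 0).integrable_id hlam)
  have hE : ∫ ω, (gap 0 ω).toReal ∂μ = 1 / lam := by
    rw [← (h.hasExpTail hlam 0).integral_id hlam,
      integral_map (hm 0).aemeasurable (by fun_prop)]
  rw [← hE]
  exact strong_law_ae_real (fun n ω => (gap n ω).toReal) hint
    (fun i j hij => h.iIndepFun_gap.indepFun hij)
    fun n => ⟨(hm n).aemeasurable, (hm 0).aemeasurable,
      (h.hasExpTail hlam n).eq (h.hasExpTail hlam 0)⟩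

/-- On `A` the pathwise bound applies, and off `A` the ratio is bounded below by 0. The latter costs
at most 2 m μ(Aᶜ) in the mean count, because the greedy count is at most m + 1 ≤ 2 m. -/
theorem lintegral_captureRatio_ge (hρ : 0 < ρ) (hD : ρ < D) (hv : 0 < v) (hv1 : v < 1)
    (hlam : 0 < lam) (hcenter : (1 + v) * ρ ≤ D) (h : IsPoissonUniform μ lam gap ang)
    {m N : ℕ} (hm : 1 ≤ m) (t : ℝ) {A : Set Ω} (hA : MeasurableSet A)
    (hAt : ∀ ω ∈ A, ∑ i ∈ Finset.range (m + 1), (gap i ω).toReal + (D - ρ) / v ≤ t ∧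
      t < ∑ i ∈ Finset.range (N + 1), (gap i ω).toReal) :
    ENNReal.ofReal ((m : ℝ) / N * (1 / (1 + 2 * lam * ρ) - 2 * μ.real Aᶜ)) ≤
      ∫⁻ ω, captureRatio ρ D v (stream gap ang ω) (fcfsPos ρ D v (stream gap ang ω)) t ∂μ := by
  set X : ℕ → Ω → ℝ := fun n ω => (gap n ω).toReal with hX
  have hXm : ∀ n, Measurable (X n) := fun n => (h.measurable_gap n).ennreal_toReal
  set G : Ω → ℝ := fun ω => greedyCount (2 * ρ) (fun k => X k ω) m with hG
  have hGi : Integrable G μ := integrable_greedyCount hXm m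
  have hGA : Integrable (A.indicator G) μ := hGi.indicator hA
  have hGE := le_integral_greedyCount hXm h.iIndepFun_gap (h.hasExpTail hlam) hlam
    (by positivity : 0 ≤ 2 * ρ) (fun _ _ => ENNReal.toReal_nonneg) m
  have hm1 : (1 : ℝ) ≤ m := by exact_mod_cast hm
  have hsplit : ∫ ω, G ω ∂μ - 2 * m * μ.real Aᶜ ≤ ∫ ω, A.indicator G ω ∂μ := by
    have hc : ∫ ω, Aᶜ.indicator (fun _ => 2 * (m : ℝ)) ω ∂μ = 2 * m * μ.real Aᶜ := by
      rw [integral_indicator_const _ hA.compl, smul_eq_mul, mul_comm]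
    rw [← hc, ← integral_sub hGi ((integrable_const _).indicator hA.compl)]
    refine integral_mono (hGi.sub ((integrable_const _).indicator hA.compl)) hGA fun ω => ?_
    by_cases hω : ω ∈ A
    · simp [hω]
    · have h1 : G ω ≤ m + 1 := by
        simp only [hG]; exact_mod_cast greedyCount_le _ _ m
      simp only [indicator_of_mem (mem_compl hω), indicator_of_notMem hω]
      linarith
  have hreal : (m : ℝ) / N * (1 / (1 + 2 * lam * ρ) - 2 * μ.real Aᶜ) ≤
      ∫ ω, A.indicator G ω / N ∂μ := by
    rw [integral_div, div_mul_eq_mul_div]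
    refine div_le_div_of_nonneg_right (le_trans ?_ hsplit) N.cast_nonneg
    have hpos : 0 < 1 + 2 * lam * ρ := by positivity
    have : (m : ℝ) / (1 + 2 * lam * ρ) ≤ ∫ ω, G ω ∂μ := by
      rw [div_le_iff₀ hpos]
      calc (m : ℝ) ≤ _ := hGE
        _ = _ := by rw [hG]; ring
    calc _ = (m : ℝ) / (1 + 2 * lam * ρ) - 2 * m * μ.real Aᶜ := by ring
      _ ≤ _ := by linarith
  refine (ENNReal.ofReal_le_ofReal hreal).trans ?_
  have hG0 : ∀ ω, 0 ≤ A.indicator G ω := fun ω => indicator_nonneg (fun _ _ => Nat.cast_nonneg _) ω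
  rw [ofReal_integral_eq_lintegral_ofReal (hGA.div_const _)
    (ae_of_all _ fun ω => div_nonneg (hG0 ω) N.cast_nonneg)]
  refine lintegral_mono_ae ?_
  filter_upwards [h.ae_gap_ne_top hlam, h.tendsto_sum_div hlam] with ω hfin hlim
  by_cases hω : ω ∈ A
  swap
  · simp [hω]
  have harr : ∀ n, ((stream gap ang ω).arr n).toReal = ∑ i ∈ Finset.range (n + 1), X i ω :=
    fun n => ENNReal.toReal_sum (s := Finset.range (n + 1)) fun i _ => hfin i
  have hmono : Monotone fun n => ((stream gap ang ω).arr n).toReal :=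
    monotone_nat_of_le_succ fun n => by
      rw [harr, harr, Finset.sum_range_succ _ (n + 1)]
      exact le_add_of_nonneg_right ENNReal.toReal_nonneg
  have hunb : ∀ t : ℝ, ∃ n, t < ((stream gap ang ω).arr n).toReal := fun t => by
    have htop : Tendsto (fun n : ℕ => ∑ i ∈ Finset.range n, X i ω) atTop atTop := by
      have := hlim.pos_mul_atTop (by positivity) (tendsto_natCast_atTop_atTop (R := ℝ))
      refine this.congr' ?_
      filter_upwards [eventually_ne_atTop 0] with n hn
      exact div_mul_cancel₀ _ (by exact_mod_cast hn)
    obtain ⟨n, hn⟩ := ((tendsto_add_atTop_iff_nat 1).2 htop).eventually_gt_atTop t |>.exists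
    exact ⟨n, by rw [harr]; exact hn⟩
  have key := greedyCount_div_le_captureRatio hρ hD hv hv1 hcenter
    (S := stream gap ang ω)
    (fun n => (ENNReal.sum_ne_top (s := Finset.range (n + 1))).2 fun i _ => hfin i) hmono hunb
    (x := fun k => X k ω) (fun n => by rw [harr, harr, Finset.sum_range_succ _ (n + 1)])
    (m := m) (N := N) (t := t) (by rw [harr]; exact (hAt ω hω).1)
    (by rw [harr]; exact (hAt ω hω).2)
  refine le_trans (le_of_eq ?_) key
  -- For `N = 0`, target 0 would arrive after `t`, although target `m` is due at the perimeter by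
  -- `t`.
  have hN : (0 : ℝ) < N := by
    rcases N.eq_zero_or_pos with rfl | hN
    · exfalso
      have h1 := (hAt ω hω).1
      have h2 := (hAt ω hω).2
      have h3 := hmono (Nat.zero_le m)
      simp only [harr, hX] at h3
      have : 0 < (D - ρ) / v := div_pos (by linarith) hv
      linarith
    · exact_mod_cast hN
  rw [indicator_of_mem hω, ENNReal.ofReal_div_of_pos hN, ENNReal.ofReal_natCast,
    ENNReal.ofReal_natCast]

theorem tendsto_measureReal_compl {A : ℕ → Set Ω} (hA : ∀ k, MeasurableSet (A k))
    (h : ∀ᵐ ω ∂μ, ∀ᶠ k in atTop, ω ∈ A k) :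
    Tendsto (fun k => μ.real (A k)ᶜ) atTop (𝓝 0) := by
  have := tendsto_measure_of_ae_tendsto_indicator_of_isFiniteMeasure (μ := μ) atTop
    MeasurableSet.empty (fun k => (hA k).compl) (by
      filter_upwards [h] with ω hω
      filter_upwards [hω] with k hk
      simp [hk])
  rw [measure_empty] at this
  exact (ENNReal.tendsto_toReal ENNReal.zero_ne_top).comp this

/-- At time (p + 1) k / lam about (p + 1) k targets have arrived, so for large k the indices p k and
(p + 2) k bracket this number with linear slack, which absorbs the constant travel time `K`. -/
theorem captureFraction_fcfs_ge (hρ : 0 < ρ) (hD : ρ < D) (hv : 0 < v) (hv1 : v < 1)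
    (hlam : 0 < lam) (hcenter : (1 + v) * ρ ≤ D) (h : IsPoissonUniform μ lam gap ang)
    {p : ℕ} (hp : 1 ≤ p) :
    ENNReal.ofReal ((p : ℝ) / (p + 2) * (1 / (1 + 2 * lam * ρ))) ≤
      captureFraction μ ρ D v gap ang (fcfsPos ρ D v) := by
  set K := (D - ρ) / v
  have hp0 : (0 : ℝ) < p := by exact_mod_cast hp
  set t : ℕ → ℝ := fun k => (p + 1) * k / lam with ht
  have htend : Tendsto t atTop atTop :=
    (tendsto_natCast_atTop_atTop.const_mul_atTop (by positivity)).atTop_div_const hlam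
  set A : ℕ → Set Ω := fun k =>
    {ω | ∑ i ∈ Finset.range (p * k + 1), (gap i ω).toReal + K ≤ t k} ∩
      {ω | t k < ∑ i ∈ Finset.range ((p + 2) * k + 1), (gap i ω).toReal} with hAdef
  have hsm : ∀ n, Measurable fun ω => ∑ i ∈ Finset.range n, (gap i ω).toReal :=
    fun n => Finset.measurable_fun_sum _ fun i _ => (h.measurable_gap i).ennreal_toReal
  have hA : ∀ k, MeasurableSet (A k) := fun k =>
    (measurableSet_le ((hsm _).add_const _) measurable_const).inter
      (measurableSet_lt measurable_const (hsm _))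
  have hAae : ∀ᵐ ω ∂μ, ∀ᶠ k in atTop, ω ∈ A k := by
    filter_upwards [h.tendsto_sum_div hlam] with ω hlim
    have hidx : ∀ q : ℕ, 1 ≤ q → Tendsto (fun k : ℕ => q * k + 1) atTop atTop := fun q hq =>
      tendsto_atTop_mono (fun k => (Nat.le_mul_of_pos_left k hq).trans (Nat.le_succ _)) tendsto_id
    -- The numerator p + 1/2 lies halfway between p and p + 1: the first half of the slack covers
    -- the error in the strong law, the other half, k / (2 lam), covers `K` and the extra summand of
    -- index p k.
    have hc1 : 1 / lam < (p + 1 / 2) / (p * lam) := by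
      rw [div_lt_div_iff₀ hlam (by positivity)]; nlinarith
    have hc2 : ((p : ℝ) + 1) / ((p + 2) * lam) < 1 / lam := by
      rw [div_lt_div_iff₀ (by positivity) hlam]; nlinarith
    have e1 := (hidx p hp).eventually (hlim.eventually_lt_const hc1)
    have e2 := (hidx (p + 2) (by omega)).eventually (hlim.eventually_const_lt hc2)
    have e3 : ∀ᶠ k : ℕ in atTop, (p + 1 / 2) / (p * lam) + K ≤ 1 / (2 * lam) * (k : ℝ) :=
      (tendsto_natCast_atTop_atTop.const_mul_atTop (by positivity)).eventually_ge_atTop _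
    filter_upwards [e1, e2, e3] with k h1 h2 h3
    rw [div_lt_iff₀ (by positivity)] at h1
    rw [lt_div_iff₀ (by positivity)] at h2
    push_cast at h1 h2
    refine ⟨?_, ?_⟩
    · simp only [mem_ofPred_eq, ht]
      have : ((p : ℝ) + 1 / 2) / (p * lam) * (p * k + 1) + 1 / (2 * lam) * k =
          (p + 1) * k / lam + (p + 1 / 2) / (p * lam) := by field_simp; ring
      linarith
    · simp only [mem_ofPred_eq, ht]
      refine lt_of_le_of_lt ?_ h2
      have : ((p : ℝ) + 1) / ((p + 2) * lam) * ((p + 2) * k + 1) =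
          (p + 1) * k / lam + (p + 1) / ((p + 2) * lam) := by field_simp
      have : 0 ≤ ((p : ℝ) + 1) / ((p + 2) * lam) := by positivity
      linarith
  have hlim := tendsto_measureReal_compl hA hAae
  have hg : Tendsto (fun k => ENNReal.ofReal ((p : ℝ) / (p + 2) *
      (1 / (1 + 2 * lam * ρ) - 2 * μ.real (A k)ᶜ))) atTop
      (𝓝 (ENNReal.ofReal ((p : ℝ) / (p + 2) * (1 / (1 + 2 * lam * ρ))))) := by
    refine (ENNReal.continuous_ofReal.tendsto _).comp (Tendsto.const_mul _ ?_)
    simpa using (hlim.const_mul 2).const_sub (1 / (1 + 2 * lam * ρ))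
  refine le_limsup_of_tendsto htend hg ?_
  filter_upwards [eventually_ge_atTop 1] with k hk
  have hk0 : (0 : ℝ) < k := by exact_mod_cast hk
  have := lintegral_captureRatio_ge hρ hD hv hv1 hlam hcenter h (m := p * k) (N := (p + 2) * k)
    (Nat.mul_pos hp hk) (t k) (hA k) fun ω hω => hω
  push_cast at this
  rwa [mul_div_mul_right _ _ hk0.ne'] at this

end Limit

end RIT

theorem mainTheorem2 {Ω : Type*} [MeasurableSpace Ω] (μ : MeasureTheory.Measure Ω)
    [MeasureTheory.IsProbabilityMeasure μ] (ρ D v lam : ℝ)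
    (hρ : 0 < ρ) (hD : ρ < D) (hv0 : 0 ≤ v) (hv1 : v < 1) (hlam : 0 ≤ lam)
    (hcenter : (1 + v) * ρ ≤ D)
    (gap : ℕ → Ω → ℝ≥0∞) (ang : ℕ → Ω → ℝ) (h : RIT.IsPoissonUniform μ lam gap ang) :
    ENNReal.ofReal (1 / (1 + 2 * lam * ρ)) ≤
      RIT.captureFraction μ ρ D v gap ang (RIT.fcfsPos ρ D v) := by
  have hpos : 0 < 1 + 2 * lam * ρ := by positivity
  have hle : ENNReal.ofReal (1 / (1 + 2 * lam * ρ)) ≤ 1 := by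
    rw [ENNReal.ofReal_le_one, div_le_one hpos]
    have : 0 ≤ 2 * lam * ρ := by positivity
    linarith
  -- For v = 0 targets stay at radius D > ρ and never escape; the ratio is then identically 1, as it
  -- is almost surely for rate 0.
  rcases hv0.eq_or_lt with rfl | hv
  · rwa [RIT.captureFraction_eq_one (MeasureTheory.ae_of_all _ fun ω t =>
      RIT.captureRatio_eq_one_of_speed_eq_zero hD _ _ t)]
  rcases hlam.eq_or_lt with rfl | hlam
  · rwa [RIT.captureFraction_eq_one (RIT.captureRatio_eq_one_of_rate_eq_zero h _)]
  have hlim : Filter.Tendsto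
      (fun p : ℕ => ENNReal.ofReal ((p : ℝ) / (p + 2) * (1 / (1 + 2 * lam * ρ)))) Filter.atTop
      (nhds (ENNReal.ofReal (1 / (1 + 2 * lam * ρ)))) := by
    refine (ENNReal.continuous_ofReal.tendsto _).comp ?_
    simpa using (tendsto_natCast_div_add_atTop (2 : ℝ)).mul_const (1 / (1 + 2 * lam * ρ))
  refine le_of_tendsto hlim ?_
  filter_upwards [Filter.eventually_ge_atTop 1] with p hp
  exact RIT.captureFraction_fcfs_ge hρ hD hv hv1 hlam hcenter h hp
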